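/- Let $\mathbb{K}$ be $\mathbb{R}$ or $\mathbb{C}$, and let $G$ be a Lie group over $\mathbb{K}$ (modelled on a finite-dimensional or, more generally, a Banach space over $\mathbb{K}$), with Lie algebra $\mathfrak{g}=T_{1_G}G$. Let $\mathcal{B}_1,\mathcal{B}_2:G\to G$ be maps that are smooth over $\mathbb{K}$, satisfy $\mathcal{B}_1(1_G)=\mathcal{B}_2(1_G)=1_G$, and form a Rota-Baxter system of groups, i.e. for all $a,b\in G$, $$\mathcal{B}_1(a)\mathcal{B}_1(b)=\mathcal{B}_1(\mathcal{B}_1(a)\,b\,\mathcal{B}_2(a)),\qquad \mathcal{B}_2(b)\mathcal{B}_2(a)=\mathcal{B}_2(\mathcal{B}_1(a)\,b\,\mathcal{B}_2(a)).$$ Let $B_1,B_2:\mathfrak{g}\to\mathfrak{g}$ be the tangent maps of $\mathcal{B}_1,\mathcal{B}_2$ at $1_G$, and let $\phi=B_1+B_2$. Then for all $u,v\in\mathfrak{g}$, $$[B_1(u),B_1(v)]=B_1\big([B_1(u),B_1(v)]-[B_2(u),B_2(v)]\big),\qquad [B_2(v),B_2(u)]=B_2\big([B_1(u),B_1(v)]-[B_2(u),B_2(v)]\big).$$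 Moreover, if $\phi$ is linear, then $(\mathfrak{g},B_1,B_2)$ is a decomposable Rota-Baxter system of Lie algebras, i.e. $B_1$ and $B_2$ are $\mathbb{K}$-linear, the two identities above hold, and $\operatorname{Ker}(\phi)\subseteq\operatorname{Ker}(B_1)$; and $\phi$ is idempotent, i.e. $\phi\circ\phi=\phi$. -/

import Mathlib

open scoped Manifold ContDiff

/-- A Rota-Baxter system of groups: two operators `B₁, B₂ : G → G` with
`B₁(a) B₁(b) = B₁(B₁(a) b B₂(a))` and `B₂(b) B₂(a) = B₂(B₁(a) b B₂(a))`. -/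
structure IsRotaBaxterSystem {G : Type*} [Group G] (B₁ B₂ : G → G) : Prop where
  mul_left : ∀ a b : G, B₁ a * B₁ b = B₁ (B₁ a * b * B₂ a)
  mul_right : ∀ a b : G, B₂ b * B₂ a = B₂ (B₁ a * b * B₂ a)

/-- A Rota-Baxter system of Lie groups: a Rota-Baxter system on a Lie group whose two operators
are smooth (over `ℂ`: complex-smooth, that is, holomorphic) and fix the identity. -/
structure IsRotaBaxterSystemLieGroup {𝕜 : Type*} [RCLike 𝕜]
    {E : Type*} [NormedAddCommGroup E] [NormedSpace 𝕜 E]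
    {H : Type*} [TopologicalSpace H] (I : ModelWithCorners 𝕜 E H)
    {G : Type*} [TopologicalSpace G] [ChartedSpace H G] [Group G] [LieGroup I ∞ G]
    (B₁ B₂ : G → G) : Prop extends IsRotaBaxterSystem B₁ B₂ where
  smooth₁ : ContMDiff I I ∞ B₁
  smooth₂ : ContMDiff I I ∞ B₂
  map_one₁ : B₁ 1 = 1
  map_one₂ : B₂ 1 = 1

/-- The tangent map at the identity of a map `B : G → G` with `B(1) = 1`, as a map
`T₁G → T₁G`. The cast identifies `T_{B(1)}G` with `T₁G` along the equality `B(1) = 1`. -/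
noncomputable def tangentMapAtOne {𝕜 : Type*} [RCLike 𝕜]
    {E : Type*} [NormedAddCommGroup E] [NormedSpace 𝕜 E]
    {H : Type*} [TopologicalSpace H] (I : ModelWithCorners 𝕜 E H)
    {G : Type*} [TopologicalSpace G] [ChartedSpace H G] [Group G]
    (B : G → G) (hB : B 1 = 1) : GroupLieAlgebra I G → GroupLieAlgebra I G :=
  fun u => cast (congrArg (fun g : G => TangentSpace I g) hB) (mfderiv I I B (1 : G) u)

/-- A Rota-Baxter system of Lie algebras: two linear operators `B₁, B₂` on a Lie algebra with
`[B₁u, B₁v] = B₁([B₁u, B₁v] - [B₂u, B₂v])` and `[B₂v, B₂u] = B₂([B₁u, B₁v] - [B₂u, B₂v])`. -/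
structure IsRotaBaxterSystemLieAlgebra (𝕜 : Type*) [CommRing 𝕜] {L : Type*} [LieRing L]
    [LieAlgebra 𝕜 L] (B₁ B₂ : L → L) : Prop where
  linear₁ : IsLinearMap 𝕜 B₁
  linear₂ : IsLinearMap 𝕜 B₂
  lie₁ : ∀ u v : L, ⁅B₁ u, B₁ v⁆ = B₁ (⁅B₁ u, B₁ v⁆ - ⁅B₂ u, B₂ v⁆)
  lie₂ : ∀ u v : L, ⁅B₂ v, B₂ u⁆ = B₂ (⁅B₁ u, B₁ v⁆ - ⁅B₂ u, B₂ v⁆)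

/-- A Rota-Baxter system of Lie algebras is decomposable if `Ker (B₁ + B₂) ⊆ Ker B₁`. -/
structure IsDecomposableRotaBaxterSystemLieAlgebra (𝕜 : Type*) [CommRing 𝕜] {L : Type*}
    [LieRing L] [LieAlgebra 𝕜 L] (B₁ B₂ : L → L) : Prop
    extends IsRotaBaxterSystemLieAlgebra 𝕜 B₁ B₂ where
  ker_subset : {u : L | B₁ u + B₂ u = 0} ⊆ {u : L | B₁ u = 0}

/-- Over `ℝ` and `ℂ`, the regularity that Mathlib requires of a Lie group for its Lie algebra
is implied by smoothness. -/
instance instLEInftyMinSmoothnessThree {𝕜 : Type*} [RCLike 𝕜] :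
    ENat.LEInfty (minSmoothness 𝕜 3) where
  out := by
    rw [minSmoothness_of_isRCLikeNormedField]
    exact ENat.LEInfty.out

/-! ### Calculus of second Fréchet derivatives. -/

section SecondDerivative

open Filter Topology

variable {𝕜 : Type*} [RCLike 𝕜]
  {E : Type*} [NormedAddCommGroup E] [NormedSpace 𝕜 E]
  {F : Type*} [NormedAddCommGroup F] [NormedSpace 𝕜 F]
  {F' : Type*} [NormedAddCommGroup F'] [NormedSpace 𝕜 F']

/-! Work in the chart at `1`. With `m` the mixed second derivative of the multiplication at the
unit, the Lie bracket is `m(u, v) - m(v, u)` (`bracket_eq_mixedDeriv`). Let `Tᵢ`, `Sᵢ` be the first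
and second derivatives of the operators and `φ = T₁ + T₂`. Differentiating the first group identity
in `a` gives `T₁ φ = T₁`; differentiating in `a` and `b` gives `m(T₁u, T₁v) = S₁(φu, v) + T₁(m(T₁u,
v) + m(v, T₂u))` (`IsLocalUnitalLaw.rotaBaxter`). Replacing `v` by `φv` keeps the left side and
turns the Hessian term into `S₁(φu, φv)`, which is symmetric and disappears on antisymmetrising;
what remains is the bracket identity (`rotaBaxter_of_mixedDeriv`). The second operator is treated
alike. The relations `Tᵢ φ = Tᵢ` also give the kernel inclusion and, when summed, the idempotence of
`φ`. -/

theorem ContDiffAt.differentiableAt_fderiv_of_two {f : E → F} {x : E} (hf : ContDiffAt 𝕜 2 f x) :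
    DifferentiableAt 𝕜 (fderiv 𝕜 f) x :=
  (hf.fderiv_right (m := 1) (by norm_num)).differentiableAt (by norm_num)

theorem ContDiffAt.eventually_differentiableAt {f : E → F} {x : E} (hf : ContDiffAt 𝕜 2 f x) :
    ∀ᶠ y in 𝓝 x, DifferentiableAt 𝕜 f y :=
  (hf.eventually (by norm_num)).mono fun _ hy => hy.differentiableAt (by norm_num)

/-- The second-order chain rule. -/
theorem fderiv_fderiv_comp {g : F → F'} {f : E → F} {x : E}
    (hg : ContDiffAt 𝕜 2 g (f x)) (hf : ContDiffAt 𝕜 2 f x) (u v : E) :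
    fderiv 𝕜 (fderiv 𝕜 (fun y => g (f y))) x u v =
      fderiv 𝕜 (fderiv 𝕜 g) (f x) (fderiv 𝕜 f x u) (fderiv 𝕜 f x v) +
        fderiv 𝕜 g (f x) (fderiv 𝕜 (fderiv 𝕜 f) x u v) := by
  have hev : fderiv 𝕜 (fun y => g (f y)) =ᶠ[𝓝 x]
      fun y => (fderiv 𝕜 g (f y)).comp (fderiv 𝕜 f y) := by
    filter_upwards [hf.eventually_differentiableAt,
      hf.continuousAt.eventually hg.eventually_differentiableAt] with y hy hgy
    exact fderiv_comp y hgy hy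
  rw [hev.fderiv_eq]
  have hg' : HasFDerivAt (fun y => fderiv 𝕜 g (f y))
      ((fderiv 𝕜 (fderiv 𝕜 g) (f x)).comp (fderiv 𝕜 f x)) x :=
    hg.differentiableAt_fderiv_of_two.hasFDerivAt.comp x
      (hf.differentiableAt (by norm_num)).hasFDerivAt
  rw [(hg'.clm_comp hf.differentiableAt_fderiv_of_two.hasFDerivAt).fderiv]
  simp [add_comm]

/-- The projections have zero second derivative, so the chain rule for each projection composed with
the pair reads off one component. -/
theorem fderiv_fderiv_prodMk {f : E → F} {g : E → F'} {x : E}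
    (hf : ContDiffAt 𝕜 2 f x) (hg : ContDiffAt 𝕜 2 g x) (u v : E) :
    fderiv 𝕜 (fderiv 𝕜 (fun y => (f y, g y))) x u v =
      (fderiv 𝕜 (fderiv 𝕜 f) x u v, fderiv 𝕜 (fderiv 𝕜 g) x u v) := by
  have h := hf.prodMk hg
  have h₁ := fderiv_fderiv_comp (g := Prod.fst) (f := fun y => (f y, g y)) (x := x)
    contDiffAt_fst h u v
  have h₂ := fderiv_fderiv_comp (g := Prod.snd) (f := fun y => (f y, g y)) (x := x)
    contDiffAt_snd h u v
  have e₁ : fderiv 𝕜 (Prod.fst : F × F' → F) = fun _ => ContinuousLinearMap.fst 𝕜 F F' := by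
    ext1 p; exact fderiv_fst
  have e₂ : fderiv 𝕜 (Prod.snd : F × F' → F') = fun _ => ContinuousLinearMap.snd 𝕜 F F' := by
    ext1 p; exact fderiv_snd
  simp only [e₁, e₂, fderiv_fun_const, Pi.zero_apply, zero_apply, zero_add,
    ContinuousLinearMap.coe_fst', ContinuousLinearMap.coe_snd'] at h₁ h₂
  exact Prod.ext h₁.symm h₂.symm

theorem fderiv_fderiv_clm (L : E →L[𝕜] F) (x : E) : fderiv 𝕜 (fderiv 𝕜 (fun y => L y)) x = 0 := by
  have : fderiv 𝕜 (fun y => L y) = fun _ => L := by ext1 p; exact L.fderiv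
  rw [this]; simp

theorem fderiv_fderiv_const (c : F) (x : E) :
    fderiv 𝕜 (fderiv 𝕜 (fun _ : E => c)) x = 0 := by
  simp

theorem fderiv_fderiv_comp_fst {f : E → F} {p : E × F'} (hf : ContDiffAt 𝕜 2 f p.1)
    (u v : E × F') :
    fderiv 𝕜 (fderiv 𝕜 (fun q : E × F' => f q.1)) p u v =
      fderiv 𝕜 (fderiv 𝕜 f) p.1 u.1 v.1 := by
  rw [fderiv_fderiv_comp (f := Prod.fst) hf contDiffAt_fst, fderiv_fst]
  have := fderiv_fderiv_clm (ContinuousLinearMap.fst 𝕜 E F') p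
  simp only [ContinuousLinearMap.coe_fst'] at this
  simp [this]

theorem fderiv_fderiv_comp_snd {f : F' → F} {p : E × F'} (hf : ContDiffAt 𝕜 2 f p.2)
    (u v : E × F') :
    fderiv 𝕜 (fderiv 𝕜 (fun q : E × F' => f q.2)) p u v =
      fderiv 𝕜 (fderiv 𝕜 f) p.2 u.2 v.2 := by
  rw [fderiv_fderiv_comp (f := Prod.snd) hf contDiffAt_snd, fderiv_snd]
  have := fderiv_fderiv_clm (ContinuousLinearMap.snd 𝕜 E F') p
  simp only [ContinuousLinearMap.coe_snd'] at this
  simp [this]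

theorem fderiv_comp_fst {f : E → F} {p : E × F'} (hf : DifferentiableAt 𝕜 f p.1) (u : E × F') :
    fderiv 𝕜 (fun q : E × F' => f q.1) p u = fderiv 𝕜 f p.1 u.1 := by
  rw [show (fun q : E × F' => f q.1) = f ∘ Prod.fst from rfl,
    fderiv_comp p hf differentiableAt_fst, fderiv_fst]; rfl

theorem fderiv_comp_snd {f : F' → F} {p : E × F'} (hf : DifferentiableAt 𝕜 f p.2) (u : E × F') :
    fderiv 𝕜 (fun q : E × F' => f q.2) p u = fderiv 𝕜 f p.2 u.2 := by
  rw [show (fun q : E × F' => f q.2) = f ∘ Prod.snd from rfl,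
    fderiv_comp p hf differentiableAt_snd, fderiv_snd]; rfl

end SecondDerivative

/-! ### Second-order expansion of a local multiplication with unit. -/

section LocalUnitalLaw

open Filter Topology

variable {𝕜 : Type*} [RCLike 𝕜] {E : Type*} [NormedAddCommGroup E] [NormedSpace 𝕜 E]

variable (𝕜) in
/-- A `C²` binary operation defined near `(e, e)` for which `e` is a two-sided unit. -/
structure IsLocalUnitalLaw (μ : E × E → E) (e : E) : Prop where
  contDiffAt : ContDiffAt 𝕜 2 μ (e, e)
  right_unit : ∀ᶠ x in 𝓝 e, μ (x, e) = x
  left_unit : ∀ᶠ x in 𝓝 e, μ (e, x) = x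

variable (𝕜) in
/-- The mixed second derivative `∂₁∂₂μ` at `(e, e)`. -/
noncomputable def mixedDeriv (μ : E × E → E) (e : E) (u v : E) : E :=
  fderiv 𝕜 (fderiv 𝕜 μ) (e, e) (u, 0) (0, v)

theorem mixedDeriv_add_left (μ : E × E → E) (e u u' v : E) :
    mixedDeriv 𝕜 μ e (u + u') v = mixedDeriv 𝕜 μ e u v + mixedDeriv 𝕜 μ e u' v := by
  have : ((u + u', 0) : E × E) = (u, 0) + (u', 0) := by simp
  rw [mixedDeriv, this, map_add, add_apply]; rfl

theorem mixedDeriv_add_right (μ : E × E → E) (e u v v' : E) :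
    mixedDeriv 𝕜 μ e u (v + v') = mixedDeriv 𝕜 μ e u v + mixedDeriv 𝕜 μ e u v' := by
  have : ((0, v + v') : E × E) = (0, v) + (0, v') := by simp
  rw [mixedDeriv, this, map_add]; rfl

theorem mixedDeriv_zero_left (μ : E × E → E) (e v : E) : mixedDeriv 𝕜 μ e 0 v = 0 := by
  rw [mixedDeriv, Prod.mk_zero_zero, map_zero, zero_apply]

theorem mixedDeriv_zero_right (μ : E × E → E) (e u : E) : mixedDeriv 𝕜 μ e u 0 = 0 := by
  rw [mixedDeriv, Prod.mk_zero_zero, map_zero]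

namespace IsLocalUnitalLaw

variable {μ : E × E → E} {e : E}

theorem self_self (h : IsLocalUnitalLaw 𝕜 μ e) : μ (e, e) = e := h.right_unit.self_of_nhds

theorem differentiableAt (h : IsLocalUnitalLaw 𝕜 μ e) : DifferentiableAt 𝕜 μ (e, e) :=
  h.contDiffAt.differentiableAt (by norm_num)

theorem fderiv_apply (h : IsLocalUnitalLaw 𝕜 μ e) (u v : E) :
    fderiv 𝕜 μ (e, e) (u, v) = u + v := by
  have h₁ : HasFDerivAt (fun x => μ (x, e))
      ((fderiv 𝕜 μ (e, e)).comp (ContinuousLinearMap.inl 𝕜 E E)) e :=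
    HasFDerivAt.comp e (g := μ) h.differentiableAt.hasFDerivAt (hasFDerivAt_prodMk_left e e)
  have h₂ : HasFDerivAt (fun x => μ (e, x))
      ((fderiv 𝕜 μ (e, e)).comp (ContinuousLinearMap.inr 𝕜 E E)) e :=
    HasFDerivAt.comp e (g := μ) h.differentiableAt.hasFDerivAt (hasFDerivAt_prodMk_right e e)
  have e₁ := h₁.unique ((hasFDerivAt_id e).congr_of_eventuallyEq h.right_unit)
  have e₂ := h₂.unique ((hasFDerivAt_id e).congr_of_eventuallyEq h.left_unit)
  have k₁ := DFunLike.congr_fun e₁ u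
  have k₂ := DFunLike.congr_fun e₂ v
  simp only [ContinuousLinearMap.comp_apply, ContinuousLinearMap.inl_apply,
    ContinuousLinearMap.inr_apply, ContinuousLinearMap.id_apply] at k₁ k₂
  calc fderiv 𝕜 μ (e, e) (u, v) = fderiv 𝕜 μ (e, e) ((u, 0) + (0, v)) := by simp
    _ = u + v := by rw [map_add, k₁, k₂]

/-- On the slice `x ↦ (x, e)` the law is the identity map, which has no second-order part. -/
theorem fderiv_fderiv_inl_inl (h : IsLocalUnitalLaw 𝕜 μ e) (u v : E) :
    fderiv 𝕜 (fderiv 𝕜 μ) (e, e) (u, 0) (v, 0) = 0 := by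
  have hd : ContDiffAt 𝕜 2 (fun x : E => (x, e)) e := contDiffAt_id.prodMk contDiffAt_const
  have key := fderiv_fderiv_comp (g := μ) (f := fun x : E => (x, e)) (x := e) h.contDiffAt hd u v
  have hid := fderiv_fderiv_clm (ContinuousLinearMap.id 𝕜 E) e
  simp only [ContinuousLinearMap.id_apply] at hid
  have hev : (fun x => μ (x, e)) =ᶠ[𝓝 e] fun x => x := h.right_unit
  rw [hev.fderiv.fderiv_eq, fderiv_fderiv_prodMk contDiffAt_fun_id contDiffAt_const, hid,
    fderiv_fderiv_const, (hasFDerivAt_prodMk_left e e).fderiv] at key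
  simp only [zero_apply, Prod.mk_zero_zero, map_zero, add_zero] at key
  exact key.symm

theorem fderiv_fderiv_inr_inr (h : IsLocalUnitalLaw 𝕜 μ e) (u v : E) :
    fderiv 𝕜 (fderiv 𝕜 μ) (e, e) (0, u) (0, v) = 0 := by
  have hd : ContDiffAt 𝕜 2 (fun x : E => (e, x)) e := contDiffAt_const.prodMk contDiffAt_id
  have key := fderiv_fderiv_comp (g := μ) (f := fun x : E => (e, x)) (x := e) h.contDiffAt hd u v
  have hid := fderiv_fderiv_clm (ContinuousLinearMap.id 𝕜 E) e
  simp only [ContinuousLinearMap.id_apply] at hid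
  have hev : (fun x => μ (e, x)) =ᶠ[𝓝 e] fun x => x := h.left_unit
  rw [hev.fderiv.fderiv_eq, fderiv_fderiv_prodMk contDiffAt_const contDiffAt_fun_id, hid,
    fderiv_fderiv_const, (hasFDerivAt_prodMk_right e e).fderiv] at key
  simp only [zero_apply, Prod.mk_zero_zero, map_zero, add_zero] at key
  exact key.symm

/-- The two pure blocks vanish by the unit laws, and symmetry of the second derivative expresses
both off-diagonal blocks through `mixedDeriv`. -/
theorem fderiv_fderiv_apply (h : IsLocalUnitalLaw 𝕜 μ e) (a b c d : E) :
    fderiv 𝕜 (fderiv 𝕜 μ) (e, e) (a, b) (c, d) =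
      mixedDeriv 𝕜 μ e a d + mixedDeriv 𝕜 μ e c b := by
  have hs : IsSymmSndFDerivAt 𝕜 μ (e, e) := h.contDiffAt.isSymmSndFDerivAt (by simp)
  have e₁ : ((a, b) : E × E) = (a, 0) + (0, b) := by simp
  have e₂ : ((c, d) : E × E) = (c, 0) + (0, d) := by simp
  rw [e₁, e₂, map_add, map_add]
  simp only [add_apply]
  rw [h.fderiv_fderiv_inl_inl, h.fderiv_fderiv_inr_inr, hs.eq (0, b) (c, 0)]
  simp [mixedDeriv, add_comm]

/-- First and second derivatives of a product of two maps taking the value `e`. -/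
theorem comp_fderiv {P : Type*} [NormedAddCommGroup P] [NormedSpace 𝕜 P]
    (h : IsLocalUnitalLaw 𝕜 μ e) {f g : P → E} {p : P} (hf : ContDiffAt 𝕜 2 f p)
    (hg : ContDiffAt 𝕜 2 g p) (hfp : f p = e) (hgp : g p = e) (u : P) :
    fderiv 𝕜 (fun q => μ (f q, g q)) p u = fderiv 𝕜 f p u + fderiv 𝕜 g p u := by
  have h₁ : DifferentiableAt 𝕜 μ (f p, g p) := by rw [hfp, hgp]; exact h.differentiableAt
  have hf' := hf.differentiableAt (by norm_num)
  have hg' := hg.differentiableAt (by norm_num)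
  have := (HasFDerivAt.comp p (g := μ) (f := fun q => (f q, g q)) h₁.hasFDerivAt
    (hf'.hasFDerivAt.prodMk hg'.hasFDerivAt)).fderiv
  rw [show (fun q => μ (f q, g q)) = μ ∘ fun q => (f q, g q) from rfl, this, hfp, hgp]
  simp [h.fderiv_apply]

theorem comp_contDiffAt {P : Type*} [NormedAddCommGroup P] [NormedSpace 𝕜 P]
    (h : IsLocalUnitalLaw 𝕜 μ e) {f g : P → E} {p : P} (hf : ContDiffAt 𝕜 2 f p)
    (hg : ContDiffAt 𝕜 2 g p) (hfp : f p = e) (hgp : g p = e) :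
    ContDiffAt 𝕜 2 (fun q => μ (f q, g q)) p := by
  have h₁ : ContDiffAt 𝕜 2 μ (f p, g p) := by rw [hfp, hgp]; exact h.contDiffAt
  exact ContDiffAt.comp p (g := μ) (f := fun q => (f q, g q)) h₁ (hf.prodMk hg)

theorem comp_fderiv_fderiv {P : Type*} [NormedAddCommGroup P] [NormedSpace 𝕜 P]
    (h : IsLocalUnitalLaw 𝕜 μ e) {f g : P → E} {p : P} (hf : ContDiffAt 𝕜 2 f p)
    (hg : ContDiffAt 𝕜 2 g p) (hfp : f p = e) (hgp : g p = e) (u v : P) :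
    fderiv 𝕜 (fderiv 𝕜 (fun q => μ (f q, g q))) p u v =
      mixedDeriv 𝕜 μ e (fderiv 𝕜 f p u) (fderiv 𝕜 g p v) +
      mixedDeriv 𝕜 μ e (fderiv 𝕜 f p v) (fderiv 𝕜 g p u) +
      (fderiv 𝕜 (fderiv 𝕜 f) p u v + fderiv 𝕜 (fderiv 𝕜 g) p u v) := by
  have h₁ : ContDiffAt 𝕜 2 μ (f p, g p) := by rw [hfp, hgp]; exact h.contDiffAt
  have hf' := hf.differentiableAt (by norm_num)
  have hg' := hg.differentiableAt (by norm_num)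
  rw [fderiv_fderiv_comp (g := μ) (f := fun q => (f q, g q)) h₁ (hf.prodMk hg),
    fderiv_fderiv_prodMk hf hg, (hf'.hasFDerivAt.prodMk hg'.hasFDerivAt).fderiv, hfp, hgp]
  simp [h.fderiv_apply, h.fderiv_fderiv_apply]

variable {b₁ b₂ β : E → E}

/-- The derivatives at `(e, e)` of `(x, y) ↦ β (b₁ x * y * b₂ x)`. -/
theorem sandwich_fderiv (h : IsLocalUnitalLaw 𝕜 μ e)
    (hb₁ : ContDiffAt 𝕜 2 b₁ e) (hb₂ : ContDiffAt 𝕜 2 b₂ e) (hβ : ContDiffAt 𝕜 2 β e)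
    (h₁ : b₁ e = e) (h₂ : b₂ e = e) :
    (∀ u, fderiv 𝕜 (fun q : E × E => β (μ (μ (b₁ q.1, q.2), b₂ q.1))) (e, e) (u, 0) =
      fderiv 𝕜 β e (fderiv 𝕜 b₁ e u + fderiv 𝕜 b₂ e u)) ∧
    (∀ u v, fderiv 𝕜 (fderiv 𝕜 (fun q : E × E => β (μ (μ (b₁ q.1, q.2), b₂ q.1)))) (e, e)
        (u, 0) (0, v) =
      fderiv 𝕜 (fderiv 𝕜 β) e (fderiv 𝕜 b₁ e u + fderiv 𝕜 b₂ e u) v +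
      fderiv 𝕜 β e (mixedDeriv 𝕜 μ e (fderiv 𝕜 b₁ e u) v +
        mixedDeriv 𝕜 μ e v (fderiv 𝕜 b₂ e u))) := by
  have d₁ := hb₁.differentiableAt (by norm_num)
  have d₂ := hb₂.differentiableAt (by norm_num)
  have c₁ : ContDiffAt 𝕜 2 (fun q : E × E => b₁ q.1) (e, e) :=
    ContDiffAt.comp (e, e) (g := b₁) (f := Prod.fst) hb₁ contDiffAt_fst
  have c₂ : ContDiffAt 𝕜 2 (fun q : E × E => b₂ q.1) (e, e) :=
    ContDiffAt.comp (e, e) (g := b₂) (f := Prod.fst) hb₂ contDiffAt_fst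
  have cy : ContDiffAt 𝕜 2 (fun q : E × E => q.2) (e, e) := contDiffAt_snd
  have cm := h.comp_contDiffAt c₁ cy h₁ rfl
  have em : μ (b₁ e, e) = e := by rw [h₁, h.self_self]
  have cc := h.comp_contDiffAt cm c₂ em h₂
  have ec : μ (μ (b₁ e, e), b₂ e) = e := by rw [em, h₂, h.self_self]
  have hβ' : ContDiffAt 𝕜 2 β (μ (μ (b₁ e, e), b₂ e)) := by rwa [ec]
  have dy : ∀ u : E × E, fderiv 𝕜 (fun q : E × E => q.2) (e, e) u = u.2 := by
    intro u; rw [fderiv_snd]; rfl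
  have ddy : fderiv 𝕜 (fderiv 𝕜 (fun q : E × E => q.2)) (e, e) = 0 :=
    fderiv_fderiv_clm (ContinuousLinearMap.snd 𝕜 E E) (e, e)
  have df₁ : ∀ u : E × E, fderiv 𝕜 (fun q : E × E => b₁ q.1) (e, e) u = fderiv 𝕜 b₁ e u.1 :=
    fun u => fderiv_comp_fst (p := (e, e)) d₁ u
  have df₂ : ∀ u : E × E, fderiv 𝕜 (fun q : E × E => b₂ q.1) (e, e) u = fderiv 𝕜 b₂ e u.1 :=
    fun u => fderiv_comp_fst (p := (e, e)) d₂ u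
  have ddf₁ : ∀ u v : E × E, fderiv 𝕜 (fderiv 𝕜 (fun q : E × E => b₁ q.1)) (e, e) u v =
    fderiv 𝕜 (fderiv 𝕜 b₁) e u.1 v.1 := fun u v => fderiv_fderiv_comp_fst (p := (e, e)) hb₁ u v
  have ddf₂ : ∀ u v : E × E, fderiv 𝕜 (fderiv 𝕜 (fun q : E × E => b₂ q.1)) (e, e) u v =
    fderiv 𝕜 (fderiv 𝕜 b₂) e u.1 v.1 := fun u v => fderiv_fderiv_comp_fst (p := (e, e)) hb₂ u v
  have dc : ∀ u : E × E, fderiv 𝕜 (fun q : E × E => μ (μ (b₁ q.1, q.2), b₂ q.1)) (e, e) u =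
      fderiv 𝕜 b₁ e u.1 + u.2 + fderiv 𝕜 b₂ e u.1 := fun u => by
    rw [h.comp_fderiv cm c₂ em h₂, h.comp_fderiv c₁ cy h₁ rfl, dy, df₁, df₂]
  constructor
  · intro u
    have := fderiv_comp (e, e) (g := β) (f := fun q : E × E => μ (μ (b₁ q.1, q.2), b₂ q.1))
      (hβ'.differentiableAt (by norm_num)) (cc.differentiableAt (by norm_num))
    rw [show (fun q : E × E => β (μ (μ (b₁ q.1, q.2), b₂ q.1))) =
      β ∘ (fun q : E × E => μ (μ (b₁ q.1, q.2), b₂ q.1)) from rfl, this,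
      ContinuousLinearMap.comp_apply, dc]
    simp [ec]
  · intro u v
    rw [fderiv_fderiv_comp (g := β) (f := fun q : E × E => μ (μ (b₁ q.1, q.2), b₂ q.1)) hβ' cc,
      dc, dc, h.comp_fderiv_fderiv cm c₂ em h₂, h.comp_fderiv_fderiv c₁ cy h₁ rfl,
      h.comp_fderiv c₁ cy h₁ rfl, h.comp_fderiv c₁ cy h₁ rfl, ddy, ddf₁, ddf₂]
    simp only [dy, df₁, df₂]
    -- As `(0, v)` has zero first coordinate, the second derivatives of `b₁` and `b₂` drop out, as
    -- does one of the two cross terms of each product.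
    simp [ec, mixedDeriv_zero_right, add_comm]

/-- A local Rota-Baxter system: tangent maps satisfy `B₁φ = B₁` and the bracket identities. -/
theorem rotaBaxter (h : IsLocalUnitalLaw 𝕜 μ e)
    (hb₁ : ContDiffAt 𝕜 2 b₁ e) (hb₂ : ContDiffAt 𝕜 2 b₂ e) (h₁ : b₁ e = e) (h₂ : b₂ e = e)
    (hl : ∀ᶠ q : E × E in 𝓝 (e, e),
      μ (b₁ q.1, b₁ q.2) = b₁ (μ (μ (b₁ q.1, q.2), b₂ q.1)))
    (hr : ∀ᶠ q : E × E in 𝓝 (e, e),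
      μ (b₂ q.2, b₂ q.1) = b₂ (μ (μ (b₁ q.1, q.2), b₂ q.1))) :
    (∀ u, fderiv 𝕜 b₁ e (fderiv 𝕜 b₁ e u + fderiv 𝕜 b₂ e u) = fderiv 𝕜 b₁ e u) ∧
    (∀ u, fderiv 𝕜 b₂ e (fderiv 𝕜 b₁ e u + fderiv 𝕜 b₂ e u) = fderiv 𝕜 b₂ e u) ∧
    (∀ u v, mixedDeriv 𝕜 μ e (fderiv 𝕜 b₁ e u) (fderiv 𝕜 b₁ e v) =
      fderiv 𝕜 (fderiv 𝕜 b₁) e (fderiv 𝕜 b₁ e u + fderiv 𝕜 b₂ e u) v +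
      fderiv 𝕜 b₁ e (mixedDeriv 𝕜 μ e (fderiv 𝕜 b₁ e u) v +
        mixedDeriv 𝕜 μ e v (fderiv 𝕜 b₂ e u))) ∧
    (∀ u v, mixedDeriv 𝕜 μ e (fderiv 𝕜 b₂ e v) (fderiv 𝕜 b₂ e u) =
      fderiv 𝕜 (fderiv 𝕜 b₂) e (fderiv 𝕜 b₁ e u + fderiv 𝕜 b₂ e u) v +
      fderiv 𝕜 b₂ e (mixedDeriv 𝕜 μ e (fderiv 𝕜 b₁ e u) v +
        mixedDeriv 𝕜 μ e v (fderiv 𝕜 b₂ e u))) := by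
  have hl' : (fun q : E × E => μ (b₁ q.1, b₁ q.2)) =ᶠ[𝓝 (e, e)]
    fun q => b₁ (μ (μ (b₁ q.1, q.2), b₂ q.1)) := hl
  have hr' : (fun q : E × E => μ (b₂ q.2, b₂ q.1)) =ᶠ[𝓝 (e, e)]
    fun q => b₂ (μ (μ (b₁ q.1, q.2), b₂ q.1)) := hr
  have d₁ := hb₁.differentiableAt (by norm_num)
  have d₂ := hb₂.differentiableAt (by norm_num)
  have cf : ∀ {b : E → E}, ContDiffAt 𝕜 2 b e →
      ContDiffAt 𝕜 2 (fun q : E × E => b q.1) (e, e) := fun {b} hb =>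
    ContDiffAt.comp (e, e) (g := b) (f := Prod.fst) hb contDiffAt_fst
  have cs : ∀ {b : E → E}, ContDiffAt 𝕜 2 b e →
      ContDiffAt 𝕜 2 (fun q : E × E => b q.2) (e, e) := fun {b} hb =>
    ContDiffAt.comp (e, e) (g := b) (f := Prod.snd) hb contDiffAt_snd
  obtain ⟨s₁, t₁⟩ := h.sandwich_fderiv hb₁ hb₂ hb₁ h₁ h₂
  obtain ⟨s₂, t₂⟩ := h.sandwich_fderiv hb₁ hb₂ hb₂ h₁ h₂
  refine ⟨fun u => ?_, fun u => ?_, fun u v => ?_, fun u v => ?_⟩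
  · rw [← s₁ u, ← hl'.fderiv_eq, h.comp_fderiv (cf hb₁) (cs hb₁) h₁ h₁,
      fderiv_comp_fst (p := (e, e)) d₁, fderiv_comp_snd (p := (e, e)) d₁]
    simp
  · rw [← s₂ u, ← hr'.fderiv_eq, h.comp_fderiv (cs hb₂) (cf hb₂) h₂ h₂,
      fderiv_comp_fst (p := (e, e)) d₂, fderiv_comp_snd (p := (e, e)) d₂]
    simp
  · rw [← t₁ u v, ← hl'.fderiv.fderiv_eq, h.comp_fderiv_fderiv (cf hb₁) (cs hb₁) h₁ h₁]
    simp only [fderiv_comp_fst (p := (e, e)) d₁, fderiv_comp_snd (p := (e, e)) d₁,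
      fderiv_fderiv_comp_fst (p := (e, e)) hb₁, fderiv_fderiv_comp_snd (p := (e, e)) hb₁]
    simp [mixedDeriv_zero_left]
  · rw [← t₂ u v, ← hr'.fderiv.fderiv_eq, h.comp_fderiv_fderiv (cs hb₂) (cf hb₂) h₂ h₂]
    simp only [fderiv_comp_fst (p := (e, e)) d₂, fderiv_comp_snd (p := (e, e)) d₂,
      fderiv_fderiv_comp_fst (p := (e, e)) hb₂, fderiv_fderiv_comp_snd (p := (e, e)) hb₂]
    simp [mixedDeriv_zero_left]

end IsLocalUnitalLaw

end LocalUnitalLaw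

/-! ### The Lie group and its bracket in the chart at the identity. -/

section Chart

open Filter Topology Set VectorField

variable {𝕜 : Type*} [RCLike 𝕜]
  {E : Type*} [NormedAddCommGroup E] [NormedSpace 𝕜 E]
  {H : Type*} [TopologicalSpace H] (I : ModelWithCorners 𝕜 E H)
  (G : Type*) [TopologicalSpace G] [ChartedSpace H G] [Group G]

/-- The multiplication of a Lie group, read in the preferred chart at `1`. -/
noncomputable def chartMul (p : E × E) : E :=
  extChartAt I (1 : G) ((extChartAt I (1 : G)).symm p.1 * (extChartAt I (1 : G)).symm p.2)

variable {G} in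
/-- A self-map of a Lie group, read in the preferred chart at `1`. -/
noncomputable def chartMap (B : G → G) (x : E) : E :=
  extChartAt I (1 : G) (B ((extChartAt I (1 : G)).symm x))

theorem tendsto_extChartAt_symm_one :
    Tendsto (extChartAt I (1 : G)).symm (𝓝 (extChartAt I (1 : G) 1)) (𝓝 1) := by
  have := continuousAt_extChartAt_symm (I := I) (1 : G)
  rwa [ContinuousAt, extChartAt_to_inv] at this

variable {G}

theorem chartMap_one {B : G → G} (h1 : B 1 = 1) :
    chartMap I B (extChartAt I (1 : G) 1) = extChartAt I (1 : G) 1 := by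
  simp [chartMap, h1]

theorem tangentMapAtOne_eq_fderiv [I.Boundaryless] {B : G → G}
    (hB : ContMDiff I I ∞ B) (h1 : B 1 = 1)
    (u : GroupLieAlgebra I G) :
    tangentMapAtOne I B h1 u = fderiv 𝕜 (chartMap I B) (extChartAt I (1 : G) 1) u := by
  have hd : MDifferentiableAt I I B 1 := hB.mdifferentiableAt (by simp)
  let T : E →L[𝕜] E := mfderiv I I B 1
  have h : HasFDerivWithinAt (writtenInExtChartAt I I 1 B) T (range I)
      (extChartAt I (1 : G) 1) := hd.hasMFDerivAt.2
  have hw : writtenInExtChartAt I I 1 B = chartMap I B := by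
    ext x
    simp [writtenInExtChartAt, chartMap, h1]
  rw [I.range_eq_univ, hasFDerivWithinAt_univ, hw] at h
  -- Every tangent space unfolds to `E`, so the cast in `tangentMapAtOne` disappears definitionally.
  exact (DFunLike.congr_fun h.fderiv u).symm

/-- Near the identity, the product read in the chart is the chart image of the product. -/
theorem eventually_chartMul_chartMap {B₁ B₂ : G → G} (h₁ : ContMDiff I I ∞ B₁)
    (h₂ : ContMDiff I I ∞ B₂) (e₁ : B₁ 1 = 1) (e₂ : B₂ 1 = 1) :
    ∀ᶠ q : E × E in 𝓝 (extChartAt I (1 : G) 1, extChartAt I (1 : G) 1),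
      chartMul I G (chartMap I B₁ q.1, chartMap I B₂ q.2) = extChartAt I (1 : G)
        (B₁ ((extChartAt I (1 : G)).symm q.1) * B₂ ((extChartAt I (1 : G)).symm q.2)) := by
  have t₁ : Tendsto (fun q : E × E => B₁ ((extChartAt I (1 : G)).symm q.1))
      (𝓝 (extChartAt I (1 : G) 1, extChartAt I (1 : G) 1)) (𝓝 1) := by
    have := h₁.continuous.tendsto 1
    rw [e₁] at this
    exact (this.comp (tendsto_extChartAt_symm_one I G)).comp continuousAt_fst
  have t₂ : Tendsto (fun q : E × E => B₂ ((extChartAt I (1 : G)).symm q.2))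
      (𝓝 (extChartAt I (1 : G) 1, extChartAt I (1 : G) 1)) (𝓝 1) := by
    have := h₂.continuous.tendsto 1
    rw [e₂] at this
    exact (this.comp (tendsto_extChartAt_symm_one I G)).comp continuousAt_snd
  filter_upwards [t₁ (extChartAt_source_mem_nhds (I := I) (1 : G)),
    t₂ (extChartAt_source_mem_nhds (I := I) (1 : G))] with q k₁ k₂
  simp only [chartMul, chartMap]
  rw [(extChartAt I (1 : G)).left_inv k₁, (extChartAt I (1 : G)).left_inv k₂]

/-- The chart and its inverse cancel only on the chart source; by continuity every intermediate
product stays there near the identity. -/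
theorem eventually_chartMap_sandwich [LieGroup I ∞ G] {B₁ B₂ B : G → G} (h₁ : ContMDiff I I ∞ B₁)
    (h₂ : ContMDiff I I ∞ B₂) (e₁ : B₁ 1 = 1) (e₂ : B₂ 1 = 1) :
    ∀ᶠ q : E × E in 𝓝 (extChartAt I (1 : G) 1, extChartAt I (1 : G) 1),
      chartMap I B (chartMul I G (chartMul I G (chartMap I B₁ q.1, q.2), chartMap I B₂ q.1)) =
        extChartAt I (1 : G) (B (B₁ ((extChartAt I (1 : G)).symm q.1) *
          (extChartAt I (1 : G)).symm q.2 * B₂ ((extChartAt I (1 : G)).symm q.1))) := by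
  have : IsTopologicalGroup G := topologicalGroup_of_lieGroup I ∞
  have s := tendsto_extChartAt_symm_one I G
  have sx : Tendsto (fun q : E × E => (extChartAt I (1 : G)).symm q.1)
      (𝓝 (extChartAt I (1 : G) 1, extChartAt I (1 : G) 1)) (𝓝 1) := s.comp continuousAt_fst
  have sy : Tendsto (fun q : E × E => (extChartAt I (1 : G)).symm q.2)
      (𝓝 (extChartAt I (1 : G) 1, extChartAt I (1 : G) 1)) (𝓝 1) := s.comp continuousAt_snd
  have c₁ := h₁.continuous.tendsto 1
  have c₂ := h₂.continuous.tendsto 1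
  rw [e₁] at c₁
  rw [e₂] at c₂
  have t₁ := c₁.comp sx
  have t₂ := c₂.comp sx
  have t₃ := t₁.mul sy
  have t₄ := t₃.mul t₂
  simp only [mul_one] at t₃ t₄
  have src := extChartAt_source_mem_nhds (I := I) (1 : G)
  filter_upwards [t₁ src, t₂ src, t₃ src, t₄ src] with q k₁ k₂ k₃ k₄
  simp only [mem_preimage, Function.comp_apply] at k₁ k₂ k₃ k₄
  simp only [chartMul, chartMap]
  rw [(extChartAt I (1 : G)).left_inv k₁, (extChartAt I (1 : G)).left_inv k₂,
    (extChartAt I (1 : G)).left_inv k₃, (extChartAt I (1 : G)).left_inv k₄]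

variable (G) [I.Boundaryless]

theorem contMDiffAt_extChartAt_symm_one [IsManifold I ∞ G] {x : E}
    (hx : x ∈ (extChartAt I (1 : G)).target) :
    ContMDiffAt 𝓘(𝕜, E) I ∞ (extChartAt I (1 : G)).symm x :=
  (contMDiffOn_extChartAt_symm (1 : G)).contMDiffAt
    ((isOpen_extChartAt_target (1 : G)).mem_nhds hx)

variable [LieGroup I ∞ G]

theorem isLocalUnitalLaw_chartMul :
    IsLocalUnitalLaw 𝕜 (chartMul I G) (extChartAt I (1 : G) 1) where
  contDiffAt := by
    have h : ContMDiffAt 𝓘(𝕜, E) I ∞ (extChartAt I (1 : G)).symm (extChartAt I (1 : G) 1) :=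
      contMDiffAt_extChartAt_symm_one I G (mem_extChartAt_target (1 : G))
    have h₁ : ContMDiffAt 𝓘(𝕜, E × E) I ∞ (fun p : E × E => (extChartAt I (1 : G)).symm p.1)
        (extChartAt I (1 : G) 1, extChartAt I (1 : G) 1) :=
      ContMDiffAt.comp (I' := 𝓘(𝕜, E)) (f := Prod.fst)
        (extChartAt I (1 : G) 1, extChartAt I (1 : G) 1) h contDiffAt_fst.contMDiffAt
    have h₂ : ContMDiffAt 𝓘(𝕜, E × E) I ∞ (fun p : E × E => (extChartAt I (1 : G)).symm p.2)
        (extChartAt I (1 : G) 1, extChartAt I (1 : G) 1) :=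
      ContMDiffAt.comp (I' := 𝓘(𝕜, E)) (f := Prod.snd)
        (extChartAt I (1 : G) 1, extChartAt I (1 : G) 1) h contDiffAt_snd.contMDiffAt
    have h₃ := h₁.mul h₂
    have h₄ : ContMDiffAt 𝓘(𝕜, E × E) 𝓘(𝕜, E) ∞ (chartMul I G)
        (extChartAt I (1 : G) 1, extChartAt I (1 : G) 1) := by
      refine ContMDiffAt.comp_of_eq (contMDiffAt_extChartAt (x := (1 : G))) h₃ ?_
      simp
    exact h₄.contDiffAt.of_le ENat.LEInfty.out
  right_unit := by
    filter_upwards [extChartAt_target_mem_nhds (I := I) (1 : G)] with x hx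
    simp only [chartMul, extChartAt_to_inv, mul_one]
    exact (extChartAt I (1 : G)).right_inv hx
  left_unit := by
    filter_upwards [extChartAt_target_mem_nhds (I := I) (1 : G)] with x hx
    simp only [chartMul, extChartAt_to_inv, one_mul]
    exact (extChartAt I (1 : G)).right_inv hx

variable {G}

theorem contDiffAt_chartMap {B : G → G} (hB : ContMDiff I I ∞ B) (h1 : B 1 = 1) :
    ContDiffAt 𝕜 2 (chartMap I B) (extChartAt I (1 : G) 1) := by
  have h : ContMDiffAt 𝓘(𝕜, E) I ∞ (extChartAt I (1 : G)).symm (extChartAt I (1 : G) 1) :=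
    contMDiffAt_extChartAt_symm_one I G (mem_extChartAt_target (1 : G))
  have h₂ := ContMDiffAt.comp (extChartAt I (1 : G) 1) hB.contMDiffAt h
  have h₃ : ContMDiffAt 𝓘(𝕜, E) 𝓘(𝕜, E) ∞ (chartMap I B) (extChartAt I (1 : G) 1) := by
    refine ContMDiffAt.comp_of_eq (contMDiffAt_extChartAt (x := (1 : G))) h₂ ?_
    simp [h1]
  exact h₃.contDiffAt.of_le ENat.LEInfty.out

/-- At `g = φ.symm x` the invariant field is the derivative of `g * ·` at `1` applied to `v`, and
pulling back by `φ.symm` applies the derivative of `φ` at `g`. The chain rule for `y ↦ φ (g * φ.symm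
y)` gives the same composite. -/
theorem mpullbackWithin_mulInvariantVectorField (v : GroupLieAlgebra I G) {x : E}
    (hx : x ∈ (extChartAt I (1 : G)).target) :
    mpullbackWithin 𝓘(𝕜, E) I (extChartAt I (1 : G)).symm (mulInvariantVectorField v) (range I) x =
      fderiv 𝕜 (fun y => chartMul I G (x, y)) (extChartAt I (1 : G) 1) v := by
  have : IsManifold I 1 G := IsManifold.of_le (n := ∞) (by simp)
  set φ := extChartAt I (1 : G) with hφ
  set g : G := φ.symm x with hg
  have hgs : g ∈ φ.source := φ.map_target hx
  have hgc : g ∈ (chartAt H (1 : G)).source := by rwa [← extChartAt_source (I := I)]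
  have hinv : (mfderivWithin 𝓘(𝕜, E) I φ.symm (range I) x).inverse =
      mfderiv I 𝓘(𝕜, E) φ g :=
    ContinuousLinearMap.inverse_eq (mfderivWithin_extChartAt_symm_comp_mfderiv_extChartAt hx)
      (mfderiv_extChartAt_comp_mfderivWithin_extChartAt_symm hx)
  let A : E →L[𝕜] E := mfderiv I 𝓘(𝕜, E) φ g
  let D : E →L[𝕜] E := mfderiv I I (g * ·) (1 : G)
  -- The preferred chart at `1` is the one identifying the tangent space at `1` with `E`, hence the
  -- identity.
  have k₁ : HasMFDerivAt 𝓘(𝕜, E) I φ.symm (φ 1) (ContinuousLinearMap.id 𝕜 E) := by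
    have h := (mdifferentiableWithinAt_extChartAt_symm (I := I)
      (mem_extChartAt_target (1 : G))).hasMFDerivWithinAt.hasMFDerivAt
      (by rw [I.range_eq_univ]; exact univ_mem)
    have heq : (mfderivWithin 𝓘(𝕜, E) I φ.symm (range I) (φ 1) : E →L[𝕜] E) =
        ContinuousLinearMap.id 𝕜 E := mfderivWithin_range_extChartAt_symm
    exact (congrArg (HasMFDerivAt 𝓘(𝕜, E) I φ.symm (φ 1)) heq).mp h
  -- The base point is left variable because `φ.symm (φ 1)` equals `1` only propositionally.
  have k₂ : ∀ y : G, y = 1 → HasMFDerivAt I I (g * ·) y D := by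
    rintro _ rfl
    exact ((contMDiff_mul_left (I := I) (n := ∞) (a := g)).mdifferentiableAt
      (by simp)).hasMFDerivAt
  have k₃ : ∀ y : G, y = g → HasMFDerivAt I 𝓘(𝕜, E) φ y A := by
    rintro _ rfl
    exact (mdifferentiableAt_extChartAt hgc).hasMFDerivAt
  have k₄ : HasMFDerivAt 𝓘(𝕜, E) 𝓘(𝕜, E) (fun y => chartMul I G (x, y)) (φ 1)
      (A.comp (D.comp (ContinuousLinearMap.id 𝕜 E))) := (k₃ (g * φ.symm (φ 1)) (by simp [hφ])).comp (φ 1)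
    ((k₂ (φ.symm (φ 1)) (by simp [hφ])).comp (φ 1) k₁)
  have k₅ : HasFDerivAt (fun y => chartMul I G (x, y))
      (A.comp (D.comp (ContinuousLinearMap.id 𝕜 E))) (φ 1) := k₄.hasFDerivAt
  rw [k₅.fderiv, mpullbackWithin_apply, hinv]
  rfl

/-- In the chart the invariant field of `w` is `x ↦ ∂₂μ(x, e) w`: its value at `e` is `w` and its
derivative there along `z` is `mixedDeriv` at `(z, w)`. The vector-field bracket `DV_v(V_u) -
DV_u(V_v)` then gives the formula. -/
theorem bracket_eq_mixedDeriv (u v : GroupLieAlgebra I G) :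
    (⁅u, v⁆ : GroupLieAlgebra I G) =
      (mixedDeriv 𝕜 (chartMul I G) (extChartAt I (1 : G) 1) u v -
        mixedDeriv 𝕜 (chartMul I G) (extChartAt I (1 : G) 1) v u : E) := by
  have : IsManifold I 1 G := IsManifold.of_le (n := ∞) (by simp)
  have hμ := isLocalUnitalLaw_chartMul I G
  set e : E := extChartAt I (1 : G) 1 with he
  let V : E → E → E := fun w => mpullbackWithin 𝓘(𝕜, E) I (extChartAt I (1 : G)).symm
      (mulInvariantVectorField (I := I) (G := G) w) (range I)
  have hev : ∀ w : E, V w =ᶠ[𝓝 e]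
      fun x => fderiv 𝕜 (chartMul I G) (x, e) (0, w) := fun w => by
    have hc : ContinuousAt (fun x : E => (x, e)) e := by fun_prop
    filter_upwards [extChartAt_target_mem_nhds (I := I) (1 : G),
      hc.eventually hμ.contDiffAt.eventually_differentiableAt] with x hx hdx
    refine (mpullbackWithin_mulInvariantVectorField I w hx).trans ?_
    have : HasFDerivAt (fun y => chartMul I G (x, y))
        ((fderiv 𝕜 (chartMul I G) (x, e)).comp (ContinuousLinearMap.inr 𝕜 E E)) e :=
      HasFDerivAt.comp e (g := chartMul I G) hdx.hasFDerivAt (hasFDerivAt_prodMk_right x e)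
    rw [this.fderiv]
    rfl
  have hval : ∀ w : E, V w e = w := fun w => by
    refine (hev w).self_of_nhds.trans ?_
    change fderiv 𝕜 (chartMul I G) (e, e) (0, w) = w
    rw [hμ.fderiv_apply, zero_add]
  have hder : ∀ w z : E, fderiv 𝕜 (V w) e z =
      mixedDeriv 𝕜 (chartMul I G) e z w := fun w z => by
    have h₁ : HasFDerivAt (fun x => fderiv 𝕜 (chartMul I G) (x, e))
        ((fderiv 𝕜 (fderiv 𝕜 (chartMul I G)) (e, e)).comp (ContinuousLinearMap.inl 𝕜 E E)) e :=
      HasFDerivAt.comp e (g := fderiv 𝕜 (chartMul I G))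
        hμ.contDiffAt.differentiableAt_fderiv_of_two.hasFDerivAt (hasFDerivAt_prodMk_left e e)
    have h₂ := h₁.clm_apply (hasFDerivAt_const ((0, w) : E × E) e)
    refine (DFunLike.congr_fun ((hev w).fderiv_eq.trans h₂.fderiv) z).trans ?_
    simp [mixedDeriv]
  -- The manifold bracket transports the chart bracket back by the inverse derivative of the chart
  -- at `1`, which is the identity.
  have hinv : ∀ L : E →L[𝕜] E, L = ContinuousLinearMap.id 𝕜 E → ∀ z, L.inverse z = z := by
    rintro _ rfl z
    rw [ContinuousLinearMap.inverse_id]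
    rfl
  have hb : ∀ u v : E, lieBracketWithin 𝕜 (V u) (V v) ((extChartAt I (1 : G)).symm ⁻¹' univ ∩ range I) e =
      mixedDeriv 𝕜 (chartMul I G) e u v - mixedDeriv 𝕜 (chartMul I G) e v u := fun u v => by
    rw [preimage_univ, univ_inter, I.range_eq_univ, lieBracketWithin_univ, lieBracket_eq]
    change fderiv 𝕜 (V v) e (V u e) - fderiv 𝕜 (V u) e (V v e) = _
    rw [hval, hval, hder, hder]
  exact (hinv _ mfderiv_extChartAt_self _).trans (hb u v)

end Chart

/-! ### Antisymmetrisation and conclusion. -/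

/-- Antisymmetrising the second-order expansion of a local Rota-Baxter system. -/
theorem rotaBaxter_of_mixedDeriv {𝕜 : Type*} [RCLike 𝕜] {E : Type*} [NormedAddCommGroup E]
    [NormedSpace 𝕜 E] (μ : E × E → E) (e : E) (T₁ T₂ : E →L[𝕜] E) {S₁ S₂ : E →L[𝕜] E →L[𝕜] E}
    (hS₁ : ∀ u v, S₁ u v = S₁ v u) (hS₂ : ∀ u v, S₂ u v = S₂ v u)
    (h₁ : ∀ u, T₁ (T₁ u + T₂ u) = T₁ u) (h₂ : ∀ u, T₂ (T₁ u + T₂ u) = T₂ u)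
    (hm₁ : ∀ u v, mixedDeriv 𝕜 μ e (T₁ u) (T₁ v) = S₁ (T₁ u + T₂ u) v +
      T₁ (mixedDeriv 𝕜 μ e (T₁ u) v + mixedDeriv 𝕜 μ e v (T₂ u)))
    (hm₂ : ∀ u v, mixedDeriv 𝕜 μ e (T₂ v) (T₂ u) = S₂ (T₁ u + T₂ u) v +
      T₂ (mixedDeriv 𝕜 μ e (T₁ u) v + mixedDeriv 𝕜 μ e v (T₂ u))) (u v : E) :
    mixedDeriv 𝕜 μ e (T₁ u) (T₁ v) - mixedDeriv 𝕜 μ e (T₁ v) (T₁ u) =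
      T₁ ((mixedDeriv 𝕜 μ e (T₁ u) (T₁ v) - mixedDeriv 𝕜 μ e (T₁ v) (T₁ u)) -
        (mixedDeriv 𝕜 μ e (T₂ u) (T₂ v) - mixedDeriv 𝕜 μ e (T₂ v) (T₂ u))) ∧
    mixedDeriv 𝕜 μ e (T₂ v) (T₂ u) - mixedDeriv 𝕜 μ e (T₂ u) (T₂ v) =
      T₂ ((mixedDeriv 𝕜 μ e (T₁ u) (T₁ v) - mixedDeriv 𝕜 μ e (T₁ v) (T₁ u)) -
        (mixedDeriv 𝕜 μ e (T₂ u) (T₂ v) - mixedDeriv 𝕜 μ e (T₂ v) (T₂ u))) := by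
  -- Evaluating at `φv` rather than `v` makes the Hessian term `S(φu, φv)`, so that it cancels
  -- against the one with `u` and `v` exchanged.
  have a := hm₁ u (T₁ v + T₂ v)
  have b := hm₁ v (T₁ u + T₂ u)
  have c := hm₂ u (T₁ v + T₂ v)
  have d := hm₂ v (T₁ u + T₂ u)
  rw [h₁] at a b
  rw [h₂] at c d
  rw [hS₁ (T₁ v + T₂ v)] at b
  rw [hS₂ (T₁ v + T₂ v)] at d
  constructor
  · nth_rewrite 1 [a, b]
    simp only [mixedDeriv_add_left, mixedDeriv_add_right, map_add, map_sub]
    abel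
  · nth_rewrite 1 [c, d]
    simp only [mixedDeriv_add_left, mixedDeriv_add_right, map_add, map_sub]
    abel

theorem mainTheorem7 {𝕜 : Type*} [RCLike 𝕜]
    {E : Type*} [NormedAddCommGroup E] [NormedSpace 𝕜 E] [CompleteSpace E]
    {H : Type*} [TopologicalSpace H] (I : ModelWithCorners 𝕜 E H) [I.Boundaryless]
    {G : Type*} [TopologicalSpace G] [ChartedSpace H G] [Group G] [LieGroup I ∞ G]
    (𝓑₁ 𝓑₂ : G → G) (h𝓑 : IsRotaBaxterSystemLieGroup I 𝓑₁ 𝓑₂)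
    (B₁ B₂ φ : GroupLieAlgebra I G → GroupLieAlgebra I G)
    (hB₁ : B₁ = tangentMapAtOne I 𝓑₁ h𝓑.map_one₁)
    (hB₂ : B₂ = tangentMapAtOne I 𝓑₂ h𝓑.map_one₂)
    (hφ : φ = fun u => B₁ u + B₂ u) :
    (∀ u v : GroupLieAlgebra I G,
      ⁅B₁ u, B₁ v⁆ = B₁ (⁅B₁ u, B₁ v⁆ - ⁅B₂ u, B₂ v⁆) ∧
      ⁅B₂ v, B₂ u⁆ = B₂ (⁅B₁ u, B₁ v⁆ - ⁅B₂ u, B₂ v⁆)) ∧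
    (IsLinearMap 𝕜 φ →
      IsDecomposableRotaBaxterSystemLieAlgebra 𝕜 B₁ B₂ ∧
      ∀ u : GroupLieAlgebra I G, φ (φ u) = φ u) := by
  have hμ := isLocalUnitalLaw_chartMul (𝕜 := 𝕜) I G
  obtain ⟨hB, hs₁, hs₂, h₁, h₂⟩ := h𝓑
  obtain ⟨hφ₁, hφ₂, hm₁, hm₂⟩ := hμ.rotaBaxter (contDiffAt_chartMap I hs₁ h₁)
    (contDiffAt_chartMap I hs₂ h₂) (chartMap_one I h₁) (chartMap_one I h₂)
    (by
      filter_upwards [eventually_chartMul_chartMap I hs₁ hs₁ h₁ h₁,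
        eventually_chartMap_sandwich I (B := 𝓑₁) hs₁ hs₂ h₁ h₂] with q k₁ k₂
      rw [k₁, k₂, hB.mul_left])
    (by
      -- The second operator reverses the order of the factors, so the product formula is used at
      -- the swapped point.
      have hswap : Filter.Tendsto (Prod.swap : E × E → E × E)
          (nhds (extChartAt I (1 : G) 1, extChartAt I (1 : G) 1))
          (nhds (extChartAt I (1 : G) 1, extChartAt I (1 : G) 1)) := continuous_swap.tendsto _
      filter_upwards [hswap.eventually (eventually_chartMul_chartMap I hs₂ hs₂ h₂ h₂),
        eventually_chartMap_sandwich I (B := 𝓑₂) hs₁ hs₂ h₁ h₂] with q k₁ k₂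
      simp only [Prod.fst_swap, Prod.snd_swap] at k₁
      rw [k₁, k₂, hB.mul_right])
  let e : E := extChartAt I (1 : G) 1
  let T₁ : E →L[𝕜] E := fderiv 𝕜 (chartMap I 𝓑₁) e
  let T₂ : E →L[𝕜] E := fderiv 𝕜 (chartMap I 𝓑₂) e
  have t₁ : B₁ = fun u => T₁ u := by
    rw [hB₁]; ext1 u; exact tangentMapAtOne_eq_fderiv I hs₁ h₁ u
  have t₂ : B₂ = fun u => T₂ u := by
    rw [hB₂]; ext1 u; exact tangentMapAtOne_eq_fderiv I hs₂ h₂ u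
  have hsymm₁ := (contDiffAt_chartMap I hs₁ h₁).isSymmSndFDerivAt (n := 2) (by simp)
  have hsymm₂ := (contDiffAt_chartMap I hs₂ h₂).isSymmSndFDerivAt (n := 2) (by simp)
  have hlie := rotaBaxter_of_mixedDeriv (chartMul I G) e T₁ T₂ hsymm₁ hsymm₂ hφ₁ hφ₂ hm₁ hm₂
  have id₁ : ∀ u v : GroupLieAlgebra I G, ⁅B₁ u, B₁ v⁆ = B₁ (⁅B₁ u, B₁ v⁆ - ⁅B₂ u, B₂ v⁆) ∧
      ⁅B₂ v, B₂ u⁆ = B₂ (⁅B₁ u, B₁ v⁆ - ⁅B₂ u, B₂ v⁆) := fun u v => by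
    simp only [t₁, t₂]
    have br := bracket_eq_mixedDeriv (I := I) (G := G)
    have hsub := congrArg₂ (fun a b : E => a - b) (br (T₁ u) (T₁ v)) (br (T₂ u) (T₂ v))
    exact ⟨(br (T₁ u) (T₁ v)).trans ((hlie u v).1.trans (congrArg T₁ hsub).symm),
      (br (T₂ v) (T₂ u)).trans ((hlie u v).2.trans (congrArg T₂ hsub).symm)⟩
  have hB₁φ : ∀ u, B₁ (B₁ u + B₂ u) = B₁ u := fun u => by rw [t₁, t₂]; exact hφ₁ u
  have hB₂φ : ∀ u, B₂ (B₁ u + B₂ u) = B₂ u := fun u => by rw [t₁, t₂]; exact hφ₂ u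
  have lin₁ : IsLinearMap 𝕜 B₁ := by rw [t₁]; exact ⟨T₁.map_add, T₁.map_smul⟩
  have lin₂ : IsLinearMap 𝕜 B₂ := by rw [t₂]; exact ⟨T₂.map_add, T₂.map_smul⟩
  refine ⟨id₁, fun _ => ⟨⟨⟨lin₁, lin₂, fun u v => (id₁ u v).1, fun u v => (id₁ u v).2⟩, ?_⟩, ?_⟩⟩
  · intro u (hu : B₁ u + B₂ u = 0)
    change B₁ u = 0
    rw [← hB₁φ u, hu, lin₁.map_zero]
  · intro u
    simp only [hφ, hB₁φ, hB₂φ]
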